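/- Let $p\in\mathbb N$ and $\alpha\in[0,1)$. Consider probability distributions $P$ of $(X,Y(1),Y(0),T)$ on $\mathbb R^p\times\mathbb R\times\mathbb R\times\{0,1\}$, and put $\Delta=Y(1)-Y(0)$ and $Y=TY(1)+(1-T)Y(0)$. Fix one of the two usual meanings of "continuous" for a law on $\mathbb R$: absolutely continuous with respect to Lebesgue measure, or without atoms. (The theorem holds for each of them.) Let $\mathcal E$ be the class of all $P$ such that at least one coordinate of $X$ has a law that is absolutely continuous with respect to Lebesgue measure on $\mathbb R$, and the laws of $Y(1)$ and of $Y(0)$ are continuous. Let $$\mathcal P_{\mathrm{SI}}=\{P\in\mathcal E:(Y(1),Y(0))\perp T\mid X\},$$ and, with $e_P(X)=P(T=1\mid X)$, $$\mathcal P_{\mathrm{SI}}^{\mathrm{str}}=\{P\in\mathcal P_{\mathrm{SI}}: e_P(X)\in[c_P,1-c_P]\ \text{a.s. for some } c_P>0\}.$$ For each $n$ let $\widehat C_n$ be a (possibly randomized) prediction set: a map that assigns to the observed data $\mathcal O_n=\{(X_i,Y_i,T_i)\}_{i=1}^n$, a random seed $U_n$ with a fixed law on a measurable space, and a point $x\in\mathbb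 R^p$, a set $\widehat C_n(x)\subseteq\mathbb R$, such that $\mathbf 1\{y\in\widehat C_n(x)\}$ is jointly measurable in $(\mathcal O_n,U_n,x,y)$. Write $\mathbb P_P$ and $\mathbb E_P$ for probability and expectation when $(X_i,Y_i(1),Y_i(0),T_i)$, $i=1,\dots,n$, and a new unit $(X,Y(1),Y(0),T)$ are i.i.d. from $P$ and $U_n$ is independent of all of them. Suppose that $$\limsup_{n\to\infty}\ \sup_{P\in\mathcal P_{\mathrm{SI}}^{\mathrm{str}}}\mathbb P_P\bigl(\Delta\notin\widehat C_n(X)\bigr)\le\alpha .$$ Then for every $P\in\mathcal P_{\mathrm{SI}}$ and every $y\in\mathbb R$, $$\limsup_{n\to\infty}\mathbb P_P\bigl(y\notin\widehat C_n(X)\bigr)\le\alpha ,$$ and for every $P\in\mathcal P_{\mathrm{SI}}$, $$\lim_{n\to\infty}\mathbb E_P\bigl[\mathrm{length}(\widehat C_n(X))\bigr]=\infty ,$$ where length is Lebesgue measure and the expectation takes values in $[0,\infty]$. -/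

import Mathlib

open MeasureTheory ProbabilityTheory Filter Topology

namespace ITE

/-- Full data of one unit: `(X, Y(1), Y(0), T)` with `X ∈ ℝ^p` and binary treatment `T`
(`true` = treated, `false` = control). -/
abbrev FullData (p : ℕ) : Type := (Fin p → ℝ) × ℝ × ℝ × Bool

/-- Observed data of one unit: `(X, Y, T)`. -/
abbrev ObsData (p : ℕ) : Type := (Fin p → ℝ) × ℝ × Bool

/-- The covariate vector `X`. -/
def covariate {p : ℕ} (d : FullData p) : Fin p → ℝ := d.1

/-- The potential outcome `Y(1)`. -/
def outcome1 {p : ℕ} (d : FullData p) : ℝ := d.2.1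

/-- The potential outcome `Y(0)`. -/
def outcome0 {p : ℕ} (d : FullData p) : ℝ := d.2.2.1

/-- The treatment indicator `T`. -/
def treatment {p : ℕ} (d : FullData p) : Bool := d.2.2.2

/-- The individual treatment effect `Δ = Y(1) - Y(0)`. -/
def effect {p : ℕ} (d : FullData p) : ℝ := outcome1 d - outcome0 d

/-- The observed part `(X, Y, T)` of a unit, with `Y = T Y(1) + (1 - T) Y(0)`. -/
def observe {p : ℕ} (d : FullData p) : ObsData p :=
  (covariate d, if treatment d = true then outcome1 d else outcome0 d, treatment d)

theorem measurable_covariate {p : ℕ} : Measurable (covariate (p := p)) := measurable_fst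

/-- The σ-algebra `σ(X)` on the space of full data. -/
abbrev sigmaX (p : ℕ) : MeasurableSpace (FullData p) :=
  MeasurableSpace.comap covariate inferInstance

theorem sigmaX_le (p : ℕ) :
    sigmaX p ≤ (inferInstance : MeasurableSpace (FullData p)) :=
  measurable_covariate.comap_le

/-- The two usual meanings of "continuous distribution" on the real line. -/
inductive Continuity : Type
  | absolutelyContinuous
  | atomless

/-- The law `μ` on `ℝ` is continuous in the chosen sense: it has a Lebesgue density, or it has no
atoms (equivalently, a continuous distribution function). -/
def Continuity.Holds : Continuity → Measure ℝ → Prop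
  | .absolutelyContinuous, μ => μ ≪ volume
  | .atomless, μ => ∀ x : ℝ, μ {x} = 0

/-- The class `𝓔`: some coordinate of `X` has an absolutely continuous law, and the laws of `Y(1)`
and of `Y(0)` are continuous. (`T` is binary by its type.) -/
def classE (κ : Continuity) (p : ℕ) : Set (ProbabilityMeasure (FullData p)) :=
  {P | (∃ j : Fin p, (P : Measure (FullData p)).map (fun d => covariate d j) ≪ volume) ∧
    κ.Holds ((P : Measure (FullData p)).map outcome1) ∧
    κ.Holds ((P : Measure (FullData p)).map outcome0)}

/-- The strongly ignorable distributions: those in `𝓔` with `(Y(1), Y(0)) ⊥ T ∣ X`. -/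
def classSI (κ : Continuity) (p : ℕ) : Set (ProbabilityMeasure (FullData p)) :=
  {P | P ∈ classE κ p ∧
    CondIndepFun (sigmaX p) (sigmaX_le p) (fun d => (outcome1 d, outcome0 d)) treatment
      (P : Measure (FullData p))}

/-- The propensity score `e_P(X) = P(T = 1 ∣ X)`, as a random variable on the full data. -/
noncomputable def propensity {p : ℕ} (P : ProbabilityMeasure (FullData p)) : FullData p → ℝ :=
  (P : Measure (FullData p))⟦treatment ⁻¹' {true} | sigmaX p⟧

/-- The strongly ignorable distributions with strong overlap: `e_P(X) ∈ [c_P, 1 - c_P]` almost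
surely, for some `c_P > 0` that may depend on `P`. -/
def classSIstr (κ : Continuity) (p : ℕ) : Set (ProbabilityMeasure (FullData p)) :=
  {P | P ∈ classSI κ p ∧
    ∃ c : ℝ, 0 < c ∧ ∀ᵐ d ∂(P : Measure (FullData p)), propensity P d ∈ Set.Icc c (1 - c)}

/-- A (possibly randomized) prediction set built from `n` observed units and a random seed in `S`;
a one-point `S` gives the non-randomized ones. The indicator of `y ∈ Ĉ(x)` is jointly measurable in
the observed data, the seed, `x` and `y`. -/
structure PredictionSet (p n : ℕ) (S : Type*) [MeasurableSpace S] where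
  /-- The set `Ĉ(x)` for given observed data, seed and `x`. -/
  toSet : (Fin n → ObsData p) → S → (Fin p → ℝ) → Set ℝ
  measurable_mem : MeasurableSet
    {z : (Fin n → ObsData p) × S × (Fin p → ℝ) × ℝ | z.2.2.2 ∈ toSet z.1 z.2.1 z.2.2.1}

section Sampling

variable {p n : ℕ} {S : Type*} [MeasurableSpace S]

/-- Joint law of `n` i.i.d. units from `P`, a seed with law `ν`, and a new unit from `P`, all
independent. -/
noncomputable def experiment (n : ℕ) (ν : Measure S) (P : ProbabilityMeasure (FullData p)) :
    Measure ((Fin n → FullData p) × S × FullData p) :=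
  (Measure.pi fun _ : Fin n => (P : Measure (FullData p))).prod
    (ν.prod (P : Measure (FullData p)))

/-- The realized prediction set `Ĉ(X)` at the covariate of the new unit. -/
def PredictionSet.realized (C : PredictionSet p n S)
    (ω : (Fin n → FullData p) × S × FullData p) : Set ℝ :=
  C.toSet (fun i => observe (ω.1 i)) ω.2.1 (covariate ω.2.2)

/-- `ℙ_P(Δ ∉ Ĉ(X))`. -/
noncomputable def PredictionSet.miscoverage (C : PredictionSet p n S) (ν : Measure S)
    (P : ProbabilityMeasure (FullData p)) : ENNReal :=
  experiment n ν P {ω | effect ω.2.2 ∉ C.realized ω}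

/-- `ℙ_P(y ∉ Ĉ(X))` for a fixed real number `y`. -/
noncomputable def PredictionSet.missProb (C : PredictionSet p n S) (ν : Measure S)
    (P : ProbabilityMeasure (FullData p)) (y : ℝ) : ENNReal :=
  experiment n ν P {ω | y ∉ C.realized ω}

/-- `𝔼_P[length Ĉ(X)] ∈ [0, ∞]`, where length is Lebesgue measure. -/
noncomputable def PredictionSet.expectedLength (C : PredictionSet p n S) (ν : Measure S)
    (P : ProbabilityMeasure (FullData p)) : ENNReal :=
  ∫⁻ ω, volume (C.realized ω) ∂(experiment n ν P)

end Sampling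

end ITE

/-!
Under strong ignorability the treatments of the sample can be written `T i = f (X i) (V i)` with
independent uniform seeds `V i`. Some coordinate of `X` has no atoms, so sufficiently fine cells of
that coordinate separate the `n` units with probability close to one, and then the sample keeps its
law when the unit `i` receives the seed attached to its cell in place of `V i`. Given the seeds of
all cells, the treatment is a deterministic function `a` of the covariate, so at every covariate
only one potential outcome is ever observed.

The other one may therefore be imputed so that the effect is identically `y`. If moreover each unit
is moved to the opposite arm with probability `1 - r`, independently of everything else, the
resulting law is strongly ignorable with strong overlap, and the law of its observed sample
dominates `r ^ n` times the previous one. The prediction set must cover `y` under this law, so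
letting `r → 1` and refining the cells shows that `y` is missed under `P` no more often than the
effect is missed in the worst case over strong overlap. Integrating over `y`, the expected length is
infinite by Tonelli's theorem as soon as this worst-case probability is less than one.
-/

namespace ITE

open scoped unitInterval

section ConditionalIndependence

variable {Ω α β γ : Type*} [MeasurableSpace Ω] [MeasurableSpace α] [MeasurableSpace β]
  [MeasurableSpace γ] {μ : Measure Ω}

theorem map_prod_noise_eq_compProd [SFinite μ] {ν : Measure β} [SFinite ν] {Z : Ω → α}
    (hZ : Measurable Z) {g : α → β → γ} (hg : Measurable (Function.uncurry g)) {η : Kernel α γ}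
    [IsSFiniteKernel η] (hη : ∀ x, ν.map (g x) = η x) :
    (μ.prod ν).map (fun z => (Z z.1, g (Z z.1) z.2)) = μ.map Z ⊗ₘ η := by
  have hgZ : Measurable fun z : Ω × β => g (Z z.1) z.2 :=
    hg.comp ((hZ.comp measurable_fst).prodMk measurable_snd)
  have hpair : Measurable fun z : Ω × β => (Z z.1, g (Z z.1) z.2) :=
    (hZ.comp measurable_fst).prodMk hgZ
  ext s hs
  rw [Measure.map_apply hpair hs, Measure.prod_apply (hpair hs), Measure.compProd_apply hs,
    lintegral_map (Kernel.measurable_kernel_prodMk_left hs) hZ]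
  refine lintegral_congr fun ω => ?_
  rw [← hη, Measure.map_apply hg.of_uncurry_left (measurable_prodMk_left hs)]
  rfl

variable [IsFiniteMeasure μ] [StandardBorelSpace γ] [Nonempty γ] {X : Ω → α} {W : Ω → β} {T : Ω → γ}

theorem condDistrib_ae_eq_of_map_eq_compProd_prodMkRight (hX : Measurable X) (hW : Measurable W)
    (hT : Measurable T) {η : Kernel α γ} [IsMarkovKernel η]
    (h : μ.map (fun ω => ((X ω, W ω), T ω)) =
      μ.map (fun ω => (X ω, W ω)) ⊗ₘ η.prodMkRight β) :
    condDistrib T X μ =ᵐ[μ.map X] η := by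
  have hXW : Measurable fun ω => (X ω, W ω) := hX.prodMk hW
  have hforget : Measurable fun z : (α × β) × γ => (z.1.1, z.2) := by fun_prop
  rw [condDistrib_ae_eq_iff_measure_eq_compProd X hT.aemeasurable]
  calc μ.map (fun ω => (X ω, T ω))
      = (μ.map (fun ω => ((X ω, W ω), T ω))).map (fun z => (z.1.1, z.2)) :=
        (Measure.map_map hforget (hXW.prodMk hT)).symm
    _ = μ.map X ⊗ₘ η := by
        rw [h]
        ext s hs
        rw [Measure.map_apply hforget hs, Measure.compProd_apply (hforget hs),
          Measure.compProd_apply hs, lintegral_map (Kernel.measurable_kernel_prodMk_left hs) hX,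
          lintegral_map (Kernel.measurable_kernel_prodMk_left (hforget hs)) hXW]
        rfl

variable [StandardBorelSpace Ω] [StandardBorelSpace β] [Nonempty β]

theorem condIndepFun_of_map_eq_compProd_prodMkRight (hX : Measurable X) (hW : Measurable W)
    (hT : Measurable T) {η : Kernel α γ} [IsMarkovKernel η]
    (h : μ.map (fun ω => ((X ω, W ω), T ω)) =
      μ.map (fun ω => (X ω, W ω)) ⊗ₘ η.prodMkRight β) :
    W ⟂ᵢ[X, hX; μ] T := by
  have hXW : Measurable fun ω => (X ω, W ω) := hX.prodMk hW
  have hcond : condDistrib T X μ =ᵐ[μ.map (Prod.fst ∘ fun ω => (X ω, W ω))] η :=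
    condDistrib_ae_eq_of_map_eq_compProd_prodMkRight hX hW hT h
  rw [condIndepFun_iff_condDistrib_prod_ae_eq_prodMkRight hT hW hX]
  refine ((condDistrib_ae_eq_iff_measure_eq_compProd _ hT.aemeasurable _).2 h).trans ?_
  rw [← Measure.map_map measurable_fst hXW] at hcond
  filter_upwards [ae_of_ae_map measurable_fst.aemeasurable hcond] with z hz using hz.symm

theorem exists_noise_of_condIndepFun (hX : Measurable X) (hW : Measurable W) (hT : Measurable T)
    (h : W ⟂ᵢ[X, hX; μ] T) :
    ∃ f : α → I → γ, Measurable (Function.uncurry f) ∧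
      μ.map (fun ω => ((X ω, W ω), T ω)) =
        (μ.prod volume).map (fun z => ((X z.1, W z.1), f (X z.1) z.2)) := by
  obtain ⟨f, hf, hfη⟩ := (condDistrib T X μ).exists_measurable_map_eq_unitInterval
  refine ⟨f, hf, ?_⟩
  have hXW : Measurable fun ω => (X ω, W ω) := hX.prodMk hW
  rw [(condDistrib_ae_eq_iff_measure_eq_compProd _ hT.aemeasurable _).1
    ((condIndepFun_iff_condDistrib_prod_ae_eq_prodMkRight hT hW hX).1 h)]
  refine (map_prod_noise_eq_compProd hXW (g := fun x => f x.1) ?_ fun x => hfη x.1).symm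
  exact hf.comp ((measurable_fst.comp measurable_fst).prodMk measurable_snd)

end ConditionalIndependence

section ProductMeasures

variable {ι κ E : Type*} [MeasurableSpace E]

theorem prod_smul_pi_le_pi [Fintype ι] {E : ι → Type*} [∀ i, MeasurableSpace (E i)]
    {μ ρ : ∀ i, Measure (E i)} [∀ i, SigmaFinite (μ i)] {r : ι → ENNReal}
    (h : ∀ i, r i • μ i ≤ ρ i) : (∏ i, r i) • Measure.pi μ ≤ Measure.pi ρ := by
  have houter : ((∏ i, r i) • Measure.pi μ).toOuterMeasure ≤
      OuterMeasure.pi fun i => (ρ i).toOuterMeasure := by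
    refine OuterMeasure.le_pi.2 fun s _ => ?_
    calc ((∏ i, r i) • Measure.pi μ) (Set.pi Set.univ s)
        = ∏ i, r i * μ i (s i) := by
          rw [Measure.smul_apply, Measure.pi_pi, smul_eq_mul, Finset.prod_mul_distrib]
      _ ≤ ∏ i, ρ i (s i) := Finset.prod_le_prod' fun i _ => h i (s i)
  refine Measure.le_iff.2 fun s hs => ?_
  calc ((∏ i, r i) • Measure.pi μ) s
      ≤ OuterMeasure.pi (fun i => (ρ i).toOuterMeasure) s := houter s
    _ = Measure.pi ρ s := by rw [Measure.pi, toMeasure_apply _ _ hs]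

/-- Along an injective `k` the family `u ∘ k` is again i.i.d.; otherwise the crude bound `1` is
used. -/
theorem lintegral_pi_le_lintegral_infinitePi_add [Fintype κ] (lam : Measure E)
    [IsProbabilityMeasure lam] {φ : (κ → E) → ENNReal} (hφ : Measurable φ) (hφ_le : ∀ v, φ v ≤ 1)
    (k : κ → ι) :
    ∫⁻ v, φ v ∂(Measure.pi fun _ => lam) ≤
      ∫⁻ u, φ (fun i => u (k i)) ∂(Measure.infinitePi fun _ : ι => lam) +
        {k : κ → ι | ¬ Function.Injective k}.indicator 1 k := by
  by_cases hk : Function.Injective k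
  · rw [← Measure.infinitePi_eq_pi, ← Measure.map_infinitePi_infinitePi_of_inj
      (P := fun _ : ι => lam) hk, lintegral_map hφ (by fun_prop)]
    exact le_self_add
  · calc ∫⁻ v, φ v ∂(Measure.pi fun _ => lam)
        ≤ ∫⁻ _, 1 ∂(Measure.pi fun _ => lam) := lintegral_mono hφ_le
      _ = {k : κ → ι | ¬ Function.Injective k}.indicator 1 k := by simp [hk]
      _ ≤ _ := le_add_self

theorem lintegral_pi_map_prod {α β : Type*} [MeasurableSpace α] [MeasurableSpace β] [Fintype κ]
    (μ : Measure α) [IsProbabilityMeasure μ] (ν : Measure β) [IsProbabilityMeasure ν]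
    {g : α → β → E} (hg : Measurable (Function.uncurry g)) {φ : (κ → E) → ENNReal}
    (hφ : Measurable φ) :
    ∫⁻ o, φ o ∂(Measure.pi fun _ => (μ.prod ν).map (Function.uncurry g)) =
      ∫⁻ d, ∫⁻ v, φ (fun i => g (d i) (v i)) ∂(Measure.pi fun _ => ν) ∂(Measure.pi fun _ => μ) := by
  have : IsProbabilityMeasure ((μ.prod ν).map (Function.uncurry g)) :=
    Measure.isProbabilityMeasure_map hg.aemeasurable
  have hjoint : Measurable fun w : (κ → α) × (κ → β) => φ fun i => g (w.1 i) (w.2 i) := by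
    refine hφ.comp (measurable_pi_lambda _ fun i => ?_)
    exact hg.comp (f := fun w : (κ → α) × (κ → β) => (w.1 i, w.2 i)) (by fun_prop)
  rw [← Measure.pi_map_pi fun _ => hg.aemeasurable, lintegral_map hφ (by fun_prop),
    ← lintegral_prod _ hjoint.aemeasurable,
    ← (measurePreserving_arrowProdEquivProdArrow α β κ (fun _ => μ) fun _ => ν).lintegral_comp
      hjoint]
  rfl

end ProductMeasures

section Collisions

variable {ι α E K : Type*} [MeasurableSpace α] [MeasurableSpace E]

theorem ae_pi_injective [Fintype ι] [MeasurableEq E] (μ : Measure E) [IsProbabilityMeasure μ]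
    [NullSingletonClass μ] : ∀ᵐ x ∂(Measure.pi fun _ : ι => μ), Function.Injective x := by
  have hne : ∀ i j : ι, i ≠ j → ∀ᵐ x ∂(Measure.pi fun _ : ι => μ), x i ≠ x j := by
    intro i j hij
    have hdiag : ∀ᵐ z ∂(μ.prod μ), z.1 ≠ z.2 :=
      Measure.ae_prod_iff_ae_ae (measurableSet_diagonal.compl) |>.2 <|
        ae_of_all _ fun x => by simpa [eq_comm] using Measure.ae_ne μ x
    rw [← Measure.infinitePi_map_eval_prod (P := fun _ : ι => μ) hij, Measure.infinitePi_eq_pi]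
      at hdiag
    exact ae_of_ae_map (f := fun x : ι → E => (x i, x j)) (by fun_prop) hdiag
  filter_upwards [ae_all_iff.2 fun i => ae_all_iff.2 fun j =>
    eventually_imp_distrib_left.2 (hne i j)] with x hx i j hij
  exact not_imp_not.1 (hx i j) hij

variable [Countable K] [MeasurableSpace K] [MeasurableSingletonClass K]

theorem measurableSet_not_injective_comp [Finite ι] {q : α → K} (hq : Measurable q) :
    MeasurableSet {d : ι → α | ¬ Function.Injective fun i => q (d i)} := by
  have hqι : Measurable fun (d : ι → α) i => q (d i) := by fun_prop
  exact hqι (MeasurableSet.of_discrete (s := {k : ι → K | ¬ Function.Injective k}))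

theorem tendsto_pi_not_injective_comp [Fintype ι] [MeasurableEq E] {μ : Measure α}
    [IsProbabilityMeasure μ] {X : α → E} (hX : Measurable X) [NullSingletonClass (μ.map X)]
    {q : ℕ → E → K} (hq : ∀ N, Measurable (q N))
    (hsep : ∀ x z, x ≠ z → ∀ᶠ N in atTop, q N x ≠ q N z) :
    Tendsto (fun N => (Measure.pi fun _ : ι => μ)
      {d | ¬ Function.Injective fun i => q N (X (d i))}) atTop (𝓝 0) := by
  have : IsProbabilityMeasure (μ.map X) := Measure.isProbabilityMeasure_map hX.aemeasurable
  have hinj : ∀ᵐ d ∂(Measure.pi fun _ : ι => μ), Function.Injective fun i => X (d i) := by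
    have h := ae_pi_injective (ι := ι) (μ.map X)
    rw [← Measure.pi_map_pi fun _ => hX.aemeasurable] at h
    exact ae_of_ae_map (Measurable.aemeasurable (by fun_prop)) h
  rw [← measure_empty (μ := Measure.pi fun _ : ι => μ)]
  refine tendsto_measure_of_ae_tendsto_indicator_of_isFiniteMeasure atTop MeasurableSet.empty
    (fun N => measurableSet_not_injective_comp ((hq N).comp hX)) ?_
  filter_upwards [hinj] with d hd
  have hcells : ∀ᶠ N in atTop, ∀ i j, i ≠ j → q N (X (d i)) ≠ q N (X (d j)) := by
    simp only [eventually_all]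
    exact fun i j hij => hsep _ _ (hd.ne hij)
  filter_upwards [hcells] with N hN
  refine iff_of_false (not_not.2 fun i j hij => ?_) (Set.notMem_empty d)
  exact not_imp_not.1 (hN i j) hij

theorem eventually_floor_mul_ne {x z : ℝ} (h : x ≠ z) :
    ∀ᶠ N : ℕ in atTop, ⌊(N : ℝ) * x⌋ ≠ ⌊(N : ℝ) * z⌋ := by
  have hlarge : ∀ᶠ N : ℕ in atTop, 1 < N * |x - z| :=
    (tendsto_natCast_atTop_atTop.atTop_mul_const
      (abs_pos.2 (sub_ne_zero.2 h))).eventually_gt_atTop 1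
  filter_upwards [hlarge] with N hN hfloor
  have hlt := Int.abs_sub_lt_one_of_floor_eq_floor hfloor
  rw [← mul_sub, abs_mul, Nat.abs_cast] at hlt
  exact lt_asymm hN hlt

/-- Units falling into distinct cells can be given the seeds of their cells instead of seeds of
their own. -/
theorem lintegral_pi_map_prod_le_add_not_injective [Fintype ι] {β : Type*} [MeasurableSpace β]
    (μ : Measure α) [IsProbabilityMeasure μ] (ν : Measure β) [IsProbabilityMeasure ν]
    {g : α → β → E} (hg : Measurable (Function.uncurry g)) {φ : (ι → E) → ENNReal}
    (hφ : Measurable φ) (hφ_le : ∀ v, φ v ≤ 1) {q : α → K} (hq : Measurable q) :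
    ∫⁻ o, φ o ∂(Measure.pi fun _ => (μ.prod ν).map (Function.uncurry g)) ≤
      ∫⁻ u, ∫⁻ d, φ (fun i => g (d i) (u (q (d i)))) ∂(Measure.pi fun _ => μ)
          ∂(Measure.infinitePi fun _ : K => ν) +
        (Measure.pi fun _ => μ) {d : ι → α | ¬ Function.Injective fun i => q (d i)} := by
  have hjoint : Measurable (Function.uncurry fun (d : ι → α) (u : K → β) =>
      φ fun i : ι => g (d i) (u (q (d i)))) := by
    refine hφ.comp (measurable_pi_lambda _ fun i => ?_)
    have hseed : Measurable fun w : (K → β) × K => w.1 w.2 :=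
      measurable_from_prod_countable_left fun k => measurable_pi_apply k
    have hdi : Measurable fun w : (ι → α) × (K → β) => w.1 i := by fun_prop
    exact hg.comp (hdi.prodMk (hseed.comp (measurable_snd.prodMk (hq.comp hdi))))
  have hcell := measurableSet_not_injective_comp (ι := ι) hq
  calc ∫⁻ o, φ o ∂(Measure.pi fun _ => (μ.prod ν).map (Function.uncurry g))
      = ∫⁻ d, ∫⁻ v, φ (fun i => g (d i) (v i)) ∂(Measure.pi fun _ => ν)
          ∂(Measure.pi fun _ => μ) := lintegral_pi_map_prod μ ν hg hφ
    _ ≤ ∫⁻ d, (∫⁻ u, φ (fun i => g (d i) (u (q (d i)))) ∂(Measure.infinitePi fun _ : K => ν) +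
          {d : ι → α | ¬ Function.Injective fun i => q (d i)}.indicator 1 d)
          ∂(Measure.pi fun _ => μ) := by
        refine lintegral_mono fun d => ?_
        refine lintegral_pi_le_lintegral_infinitePi_add ν (φ := fun v => φ fun i => g (d i) (v i))
          (hφ.comp (measurable_pi_lambda _ fun i => ?_)) (fun v => hφ_le _) fun i => q (d i)
        exact hg.of_uncurry_left.comp (measurable_pi_apply i)
    _ = _ := by
        rw [lintegral_add_right _ (measurable_one.indicator hcell), lintegral_indicator_one hcell,
          lintegral_lintegral_swap hjoint.aemeasurable]

end Collisions

section SurrogateUnits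

variable {p : ℕ}

attribute [fun_prop] measurable_covariate

@[fun_prop]
theorem measurable_outcome1 : Measurable (outcome1 (p := p)) := by
  unfold outcome1; fun_prop

@[fun_prop]
theorem measurable_outcome0 : Measurable (outcome0 (p := p)) := by
  unfold outcome0; fun_prop

@[fun_prop]
theorem measurable_treatment : Measurable (treatment (p := p)) := by
  unfold treatment; fun_prop

@[fun_prop]
theorem measurable_effect : Measurable (effect (p := p)) := by
  unfold effect; fun_prop

/-- What is observed of a unit that is placed in the arm `t`, whatever its own treatment. -/
def observeAs (t : Bool) (d : FullData p) : ObsData p :=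
  (covariate d, if t = true then outcome1 d else outcome0 d, t)

@[fun_prop]
theorem measurable_observeAs {Ω : Type*} [MeasurableSpace Ω] {t : Ω → Bool} {d : Ω → FullData p}
    (ht : Measurable t) (hd : Measurable d) : Measurable fun ω => observeAs (t ω) (d ω) := by
  have h : MeasurableSet {ω | t ω = true} := ht (measurableSet_singleton true)
  exact (measurable_covariate.comp hd).prodMk
    ((Measurable.ite h (measurable_outcome1.comp hd) (measurable_outcome0.comp hd)).prodMk ht)

@[fun_prop]
theorem measurable_observe : Measurable (observe (p := p)) :=
  measurable_observeAs measurable_treatment measurable_id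

/-- The unit `d` modified so that its effect is exactly `y`: the potential outcome of the arm
`a (covariate d)` is kept and the other one imputed. The unit is placed in that arm if `b` is
`false`, and in the opposite one if `b` is `true`. -/
def surrogate (a : (Fin p → ℝ) → Bool) (y : ℝ) (d : FullData p) (b : Bool) : FullData p :=
  (covariate d, if a (covariate d) = true then outcome1 d else outcome0 d + y,
    if a (covariate d) = true then outcome1 d - y else outcome0 d, xor (a (covariate d)) b)

variable {a : (Fin p → ℝ) → Bool}

theorem measurable_surrogate (ha : Measurable a) (y : ℝ) :
    Measurable (Function.uncurry (surrogate a y)) := by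
  have hA : MeasurableSet {z : FullData p × Bool | a (covariate z.1) = true} :=
    (ha.comp (measurable_covariate.comp measurable_fst)) (measurableSet_singleton true)
  have hxor : Measurable (Function.uncurry xor) := measurable_of_countable _
  exact (measurable_covariate.comp measurable_fst).prodMk
    ((Measurable.ite hA (by fun_prop) (by fun_prop)).prodMk
      ((Measurable.ite hA (by fun_prop) (by fun_prop)).prodMk
        (hxor.comp ((ha.comp (measurable_covariate.comp measurable_fst)).prodMk measurable_snd))))

theorem effect_surrogate (y : ℝ) (d : FullData p) (b : Bool) : effect (surrogate a y d b) = y := by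
  by_cases h : a (covariate d) = true <;> simp [effect, surrogate, outcome1, outcome0, h]

theorem observe_surrogate_false (y : ℝ) (d : FullData p) :
    observe (surrogate a y d false) = observeAs (a (covariate d)) d := by
  refine Prod.ext rfl (Prod.ext ?_ ?_)
  · cases h : a (covariate d) <;>
      simp [observe, observeAs, surrogate, outcome1, outcome0, treatment, h]
  · simp [observe, observeAs, surrogate, treatment]

/-- The law of a surrogate unit whose arm is switched according to an independent coin. -/
noncomputable def surrogateLaw (P : ProbabilityMeasure (FullData p))
    (coin : ProbabilityMeasure Bool) (ha : Measurable a) (y : ℝ) :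
    ProbabilityMeasure (FullData p) :=
  (P.prod coin).map (measurable_surrogate ha y).aemeasurable

variable (P : ProbabilityMeasure (FullData p)) (coin : ProbabilityMeasure Bool) (ha : Measurable a)
  (y : ℝ)

theorem toMeasure_surrogateLaw : (surrogateLaw P coin ha y : Measure (FullData p)) =
    ((P : Measure (FullData p)).prod (coin : Measure Bool)).map
      (Function.uncurry (surrogate a y)) := rfl

theorem map_surrogateLaw_of_forall_eq {E : Type*} [MeasurableSpace E] {f g : FullData p → E}
    (hf : Measurable f) (hfg : ∀ d b, f (surrogate a y d b) = g d) :
    (surrogateLaw P coin ha y : Measure (FullData p)).map f = (P : Measure (FullData p)).map g := by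
  have hg : g = f ∘ Function.uncurry (surrogate a y) ∘ fun d => (d, false) := by
    ext1 d; exact (hfg d false).symm
  have hgm : Measurable g := hg ▸ hf.comp ((measurable_surrogate ha y).comp (by fun_prop))
  have hcomp : f ∘ Function.uncurry (surrogate a y) = g ∘ Prod.fst := by
    ext1 z; exact hfg z.1 z.2
  rw [toMeasure_surrogateLaw, Measure.map_map hf (measurable_surrogate ha y), hcomp,
    ← Measure.map_map hgm measurable_fst, Measure.map_fst_prod, measure_univ, one_smul]

theorem map_covariate_surrogateLaw :
    (surrogateLaw P coin ha y : Measure (FullData p)).map covariate =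
      (P : Measure (FullData p)).map covariate :=
  map_surrogateLaw_of_forall_eq P coin ha y measurable_covariate fun _ _ => rfl

theorem ae_effect_surrogateLaw :
    ∀ᵐ d ∂(surrogateLaw P coin ha y : Measure (FullData p)), effect d = y :=
  (ae_map_iff (measurable_surrogate ha y).aemeasurable
    (measurable_effect (measurableSet_singleton y))).2 <|
      ae_of_all _ fun z => effect_surrogate y z.1 z.2

theorem smul_map_observeAs_le_map_observe_surrogateLaw :
    (coin : Measure Bool) {false} •
        (P : Measure (FullData p)).map (fun d => observeAs (a (covariate d)) d) ≤
      (surrogateLaw P coin ha y : Measure (FullData p)).map observe := by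
  have hobs : Measurable fun d : FullData p => observeAs (a (covariate d)) d := by fun_prop
  refine Measure.le_iff.2 fun s hs => ?_
  calc ((coin : Measure Bool) {false} •
        (P : Measure (FullData p)).map (fun d => observeAs (a (covariate d)) d)) s
      = ((P : Measure (FullData p)).prod (coin : Measure Bool))
          (((fun d => observeAs (a (covariate d)) d) ⁻¹' s) ×ˢ {false}) := by
        rw [Measure.prod_prod, Measure.smul_apply, Measure.map_apply hobs hs, smul_eq_mul, mul_comm]
    _ ≤ ((P : Measure (FullData p)).prod (coin : Measure Bool))
          (Function.uncurry (surrogate a y) ⁻¹' (observe ⁻¹' s)) := by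
        refine measure_mono ?_
        rintro ⟨d, b⟩ ⟨hd, rfl⟩
        simpa only [Set.mem_preimage, Function.uncurry_apply_pair, observe_surrogate_false] using hd
    _ = (surrogateLaw P coin ha y : Measure (FullData p)).map observe s := by
        rw [Measure.map_apply measurable_observe hs, toMeasure_surrogateLaw,
          Measure.map_apply (measurable_surrogate ha y) (measurable_observe hs)]

end SurrogateUnits

section ClassMembership

theorem Continuity.Holds.of_le_add {κ : Continuity} {ρ ρ₁ ρ₂ : Measure ℝ} (h₁ : κ.Holds ρ₁)
    (h₂ : κ.Holds ρ₂) (h : ρ ≤ ρ₁ + ρ₂) : κ.Holds ρ := by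
  cases κ with
  | absolutelyContinuous =>
    exact (Measure.absolutelyContinuous_of_le h).trans (Measure.AbsolutelyContinuous.add_left h₁ h₂)
  | atomless =>
    intro x
    refine le_antisymm ((h {x}).trans_eq ?_) zero_le
    rw [Measure.add_apply, h₁ x, h₂ x, add_zero]

theorem Continuity.Holds.map_add_const {κ : Continuity} {ρ : Measure ℝ} (h : κ.Holds ρ) (z : ℝ) :
    κ.Holds (ρ.map (· + z)) := by
  cases κ with
  | absolutelyContinuous =>
    have hmap := Measure.AbsolutelyContinuous.map h (measurable_add_const z)
    rwa [map_add_right_eq_self (volume : Measure ℝ) z] at hmap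
  | atomless =>
    intro x
    have hpre : (· + z) ⁻¹' {x} = {x - z} := by ext t; exact eq_sub_iff_add_eq.symm
    rw [Measure.map_apply (measurable_add_const z) (measurableSet_singleton x), hpre]
    exact h (x - z)

theorem Continuity.Holds.map_ite {Ω : Type*} [MeasurableSpace Ω] {μ : Measure Ω} {κ : Continuity}
    {f g : Ω → ℝ} (hf : Measurable f) (hg : Measurable g) (hκf : κ.Holds (μ.map f))
    (hκg : κ.Holds (μ.map g)) {q : Ω → Prop} [DecidablePred q] (hq : MeasurableSet {ω | q ω}) :
    κ.Holds (μ.map fun ω => if q ω then f ω else g ω) := by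
  refine hκf.of_le_add hκg (Measure.le_iff.2 fun s hs => ?_)
  rw [Measure.add_apply, Measure.map_apply hf hs, Measure.map_apply hg hs,
    Measure.map_apply (Measurable.ite hq hf hg) hs]
  refine (measure_mono fun ω hω => ?_).trans (measure_union_le _ _)
  by_cases h : q ω
  · exact Or.inl (by simpa [h] using hω)
  · exact Or.inr (by simpa [h] using hω)

variable {p : ℕ} {a : (Fin p → ℝ) → Bool} {κ : Continuity} {P : ProbabilityMeasure (FullData p)}

theorem surrogateLaw_mem_classE (hP : P ∈ classE κ p) (coin : ProbabilityMeasure Bool)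
    (ha : Measurable a) (y : ℝ) : surrogateLaw P coin ha y ∈ classE κ p := by
  obtain ⟨⟨j, hj⟩, h₁, h₀⟩ := hP
  have hA : MeasurableSet {d : FullData p | a (covariate d) = true} :=
    (ha.comp measurable_covariate) (measurableSet_singleton true)
  refine ⟨⟨j, ?_⟩, ?_, ?_⟩
  · rwa [map_surrogateLaw_of_forall_eq P coin ha y (g := fun d => covariate d j) (by fun_prop)
      fun _ _ => rfl]
  · rw [map_surrogateLaw_of_forall_eq P coin ha y measurable_outcome1 fun _ _ => rfl]
    have hshift := h₀.map_add_const y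
    rw [Measure.map_map (measurable_add_const y) measurable_outcome0] at hshift
    exact h₁.map_ite measurable_outcome1 (by fun_prop) hshift hA
  · rw [map_surrogateLaw_of_forall_eq P coin ha y measurable_outcome0 fun _ _ => rfl]
    have hshift := h₁.map_add_const (-y)
    rw [Measure.map_map (measurable_add_const (-y)) measurable_outcome1] at hshift
    simpa only [sub_eq_add_neg] using! hshift.map_ite (by fun_prop) measurable_outcome0 h₀ hA

/-- The conditional law of the arm of a surrogate unit given its covariate. -/
noncomputable def armKernel (coin : ProbabilityMeasure Bool) (ha : Measurable a) :
    Kernel (Fin p → ℝ) Bool :=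
  (Kernel.ofFunOfCountable fun t : Bool => (coin : Measure Bool).map (xor t)).comap a ha

theorem armKernel_apply (coin : ProbabilityMeasure Bool) (ha : Measurable a) (x : Fin p → ℝ) :
    armKernel coin ha x = (coin : Measure Bool).map (xor (a x)) := rfl

instance (coin : ProbabilityMeasure Bool) (ha : Measurable a) :
    IsMarkovKernel (armKernel coin ha) :=
  ⟨fun x => Measure.isProbabilityMeasure_map (μ := (coin : Measure Bool)) (f := xor (a x))
    (measurable_of_countable _).aemeasurable⟩

variable (P) (coin : ProbabilityMeasure Bool) (ha : Measurable a) (y : ℝ)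

theorem map_surrogateLaw_eq_compProd_armKernel :
    (surrogateLaw P coin ha y : Measure (FullData p)).map
        (fun d => ((covariate d, outcome1 d, outcome0 d), treatment d)) =
      (surrogateLaw P coin ha y : Measure (FullData p)).map
          (fun d => (covariate d, outcome1 d, outcome0 d)) ⊗ₘ
        (armKernel coin ha).prodMkRight (ℝ × ℝ) := by
  have hxor : Measurable (Function.uncurry xor) := measurable_of_countable _
  have hnoise : Measurable (Function.uncurry fun (z : (Fin p → ℝ) × ℝ × ℝ) => xor (a z.1)) :=
    hxor.comp ((ha.comp (measurable_fst.comp measurable_fst)).prodMk measurable_snd)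
  have hZ : Measurable fun d : FullData p =>
      (fun d => (covariate d, outcome1 d, outcome0 d)) (surrogate a y d false) := by
    have := (measurable_surrogate ha y).of_uncurry_right (y := false)
    fun_prop
  rw [map_surrogateLaw_of_forall_eq P coin ha y
      (f := fun d => (covariate d, outcome1 d, outcome0 d))
      (g := fun d => (fun d => (covariate d, outcome1 d, outcome0 d)) (surrogate a y d false))
      (by fun_prop) fun _ _ => rfl,
    ← map_prod_noise_eq_compProd (ν := (coin : Measure Bool)) hZ hnoise fun z => rfl,
    toMeasure_surrogateLaw, Measure.map_map (by fun_prop) (measurable_surrogate ha y)]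
  rfl

theorem condIndepFun_surrogateLaw :
    (fun d => (outcome1 d, outcome0 d)) ⟂ᵢ[covariate, measurable_covariate;
      (surrogateLaw P coin ha y : Measure (FullData p))] treatment :=
  condIndepFun_of_map_eq_compProd_prodMkRight measurable_covariate (by fun_prop)
    measurable_treatment (map_surrogateLaw_eq_compProd_armKernel P coin ha y)

theorem propensity_surrogateLaw :
    propensity (surrogateLaw P coin ha y) =ᵐ[(surrogateLaw P coin ha y : Measure (FullData p))]
      fun d => (armKernel coin ha (covariate d)).real {true} := by
  have hcond := condDistrib_ae_eq_of_map_eq_compProd_prodMkRight measurable_covariate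
    (by fun_prop) measurable_treatment (map_surrogateLaw_eq_compProd_armKernel P coin ha y)
  filter_upwards [condDistrib_ae_eq_condExp
    (μ := (surrogateLaw P coin ha y : Measure (FullData p))) measurable_covariate
    measurable_treatment (measurableSet_singleton true),
    ae_of_ae_map measurable_covariate.aemeasurable hcond] with d hprop hd
  rw [← hd]
  exact hprop.symm

theorem surrogateLaw_mem_classSIstr {P : ProbabilityMeasure (FullData p)} (hP : P ∈ classE κ p)
    {coin : ProbabilityMeasure Bool} (hcoin : ∀ b, (coin : Measure Bool) {b} ≠ 0) :
    surrogateLaw P coin ha y ∈ classSIstr κ p := by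
  refine ⟨⟨surrogateLaw_mem_classE hP coin ha y, condIndepFun_surrogateLaw P coin ha y⟩, ?_⟩
  have hsum : (coin : Measure Bool).real {false} + (coin : Measure Bool).real {true} = 1 := by
    have := probReal_add_probReal_compl (μ := (coin : Measure Bool)) (measurableSet_singleton false)
    rwa [Bool.compl_singleton] at this
  have hpos (b : Bool) : 0 < (coin : Measure Bool).real {b} :=
    ENNReal.toReal_pos (hcoin b) (measure_ne_top _ _)
  obtain ⟨c, hc, hc_lt⟩ := exists_between (lt_min (hpos false) (hpos true))
  have hcf := hc_lt.trans_le (min_le_left _ _)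
  have hct := hc_lt.trans_le (min_le_right _ _)
  refine ⟨c, hc, ?_⟩
  filter_upwards [propensity_surrogateLaw P coin ha y] with d hd
  have hpre : xor (a (covariate d)) ⁻¹' {true} = {!a (covariate d)} := by
    ext b; cases b <;> cases a (covariate d) <;> simp
  rw [hd, armKernel_apply, map_measureReal_apply (measurable_of_countable _)
    (measurableSet_singleton true), hpre]
  cases a (covariate d) <;> constructor <;> simp only [Bool.not_false, Bool.not_true] <;> linarith

end ClassMembership

section PredictionSets

variable {p n : ℕ} {S : Type*} [MeasurableSpace S] (C : PredictionSet p n S) (ν : Measure S)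

/-- The probability that `y` is missed at a new covariate with law `ρ`, given the observed data. -/
noncomputable def PredictionSet.condMissProb (ρ : Measure (Fin p → ℝ)) (y : ℝ)
    (o : Fin n → ObsData p) : ENNReal :=
  (ν.prod ρ) {z | y ∉ C.toSet o z.1 z.2}

theorem PredictionSet.measurableSet_notMem (y : ℝ) :
    MeasurableSet {z : (Fin n → ObsData p) × S × (Fin p → ℝ) | y ∉ C.toSet z.1 z.2.1 z.2.2} := by
  have h : Measurable (fun z : (Fin n → ObsData p) × S × (Fin p → ℝ) =>
      (z.1, z.2.1, z.2.2, y)) := by fun_prop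
  exact (h C.measurable_mem).compl

theorem PredictionSet.measurable_condMissProb [SFinite ν] (ρ : Measure (Fin p → ℝ)) [SFinite ρ]
    (y : ℝ) : Measurable (C.condMissProb ν ρ y) :=
  measurable_measure_prodMk_left (ν := ν.prod ρ) (C.measurableSet_notMem y)

instance (P : ProbabilityMeasure (FullData p)) :
    IsProbabilityMeasure ((P : Measure (FullData p)).map covariate) :=
  Measure.isProbabilityMeasure_map measurable_covariate.aemeasurable

instance (P : ProbabilityMeasure (FullData p)) :
    IsProbabilityMeasure ((P : Measure (FullData p)).map observe) :=
  Measure.isProbabilityMeasure_map measurable_observe.aemeasurable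

theorem PredictionSet.missProb_eq_lintegral [SFinite ν] (P : ProbabilityMeasure (FullData p))
    (y : ℝ) :
    C.missProb ν P y = ∫⁻ o, C.condMissProb ν ((P : Measure (FullData p)).map covariate) y o
      ∂(Measure.pi fun _ => (P : Measure (FullData p)).map observe) := by
  have hobs : Measurable fun (d : Fin n → FullData p) i => observe (d i) := by fun_prop
  have hnew : Measurable (Prod.map (id : S → S) (covariate (p := p))) :=
    measurable_id.prodMap measurable_covariate
  have hmiss : MeasurableSet {ω : (Fin n → FullData p) × S × FullData p | y ∉ C.realized ω} :=
    (hobs.prodMap hnew) (C.measurableSet_notMem y)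
  have hlaw : ν.prod ((P : Measure (FullData p)).map covariate) =
      (ν.prod (P : Measure (FullData p))).map (Prod.map id covariate) := by
    rw [← Measure.map_prod_map _ _ measurable_id measurable_covariate, Measure.map_id]
  rw [← Measure.pi_map_pi fun _ => measurable_observe.aemeasurable,
    lintegral_map (C.measurable_condMissProb ν _ y) hobs, PredictionSet.missProb, experiment,
    Measure.prod_apply hmiss]
  refine lintegral_congr fun d => ?_
  rw [PredictionSet.condMissProb, hlaw]
  exact (Measure.map_apply hnew (measurable_prodMk_left (x := fun i => observe (d i))
    (C.measurableSet_notMem y))).symm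

theorem PredictionSet.miscoverage_eq_missProb {P : ProbabilityMeasure (FullData p)}
    {y : ℝ} (h : ∀ᵐ d ∂(P : Measure (FullData p)), effect d = y) :
    C.miscoverage ν P = C.missProb ν P y := by
  refine measure_congr ?_
  have hnew : ∀ᵐ ω ∂(experiment n ν P), effect ω.2.2 = y :=
    (Measure.quasiMeasurePreserving_snd.comp Measure.quasiMeasurePreserving_snd).ae h
  filter_upwards [hnew] with ω hω
  exact congrArg (fun t => t ∉ C.realized ω) hω

variable {κ : Continuity} {P : ProbabilityMeasure (FullData p)}

theorem PredictionSet.pow_mul_lintegral_condMissProb_observeAs_le [SFinite ν]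
    {a : (Fin p → ℝ) → Bool} (ha : Measurable a) (coin : ProbabilityMeasure Bool) (y : ℝ) :
    (coin : Measure Bool) {false} ^ n *
      ∫⁻ d, C.condMissProb ν ((P : Measure (FullData p)).map covariate) y
        (fun i => observeAs (a (covariate (d i))) (d i))
        ∂(Measure.pi fun _ => (P : Measure (FullData p))) ≤
      C.miscoverage ν (surrogateLaw P coin ha y) := by
  have hobs : Measurable fun d : FullData p => observeAs (a (covariate d)) d := by fun_prop
  have : IsProbabilityMeasure ((P : Measure (FullData p)).map
      fun d => observeAs (a (covariate d)) d) :=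
    Measure.isProbabilityMeasure_map hobs.aemeasurable
  have hdom := prod_smul_pi_le_pi fun _ : Fin n =>
    smul_map_observeAs_le_map_observe_surrogateLaw P coin ha y
  rw [Finset.prod_const, Finset.card_univ, Fintype.card_fin] at hdom
  rw [C.miscoverage_eq_missProb ν (ae_effect_surrogateLaw P coin ha y), C.missProb_eq_lintegral,
    map_covariate_surrogateLaw]
  refine le_trans (le_of_eq ?_) (lintegral_mono' hdom le_rfl)
  rw [lintegral_smul_measure, smul_eq_mul, ← Measure.pi_map_pi fun _ => hobs.aemeasurable,
    lintegral_map (C.measurable_condMissProb ν _ y) (by fun_prop)]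

theorem le_of_forall_pow_mul_le {x y : ENNReal}
    (h : ∀ r : ENNReal, r ≠ 0 → r < 1 → r ^ n * x ≤ y) : x ≤ y := by
  have hlim : Tendsto (fun r : ENNReal => r ^ n * x) (𝓝[<] 1) (𝓝 (1 ^ n * x)) :=
    ENNReal.Tendsto.mul_const (((ENNReal.continuous_pow n).tendsto 1).mono_left nhdsWithin_le_nhds)
      (Or.inl (by simp))
  rw [one_pow, one_mul] at hlim
  have : (𝓝[<] (1 : ENNReal)).NeBot := nhdsLT_neBot_of_exists_lt ⟨0, one_pos⟩
  refine le_of_tendsto hlim ?_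
  filter_upwards [Ioo_mem_nhdsLT (one_pos : (0 : ENNReal) < 1)] with r hr
  exact h r hr.1.ne' hr.2

theorem exists_bool_law_singleton_false_eq {r : ENNReal} (hr₀ : r ≠ 0) (hr₁ : r < 1) :
    ∃ coin : ProbabilityMeasure Bool, (coin : Measure Bool) {false} = r ∧
      ∀ b, (coin : Measure Bool) {b} ≠ 0 := by
  refine ⟨⟨r • Measure.dirac false + (1 - r) • Measure.dirac true, ⟨?_⟩⟩, ?_, ?_⟩
  · simp [add_tsub_cancel_of_le hr₁.le]
  · simp
  · rintro (_ | _)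
    · simpa using hr₀
    · simpa using (tsub_pos_of_lt hr₁).ne'

theorem PredictionSet.lintegral_condMissProb_observeAs_le [SFinite ν] (hP : P ∈ classE κ p)
    {a : (Fin p → ℝ) → Bool} (ha : Measurable a) (y : ℝ) :
    ∫⁻ d, C.condMissProb ν ((P : Measure (FullData p)).map covariate) y
        (fun i => observeAs (a (covariate (d i))) (d i))
        ∂(Measure.pi fun _ => (P : Measure (FullData p))) ≤
      ⨆ Q ∈ classSIstr κ p, C.miscoverage ν Q := by
  refine le_of_forall_pow_mul_le (n := n) fun r hr₀ hr₁ => ?_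
  obtain ⟨coin, rfl, hcoin⟩ := exists_bool_law_singleton_false_eq hr₀ hr₁
  exact (C.pow_mul_lintegral_condMissProb_observeAs_le ν ha coin y).trans
    (le_iSup₂ (f := fun Q _ => C.miscoverage ν Q) (surrogateLaw P coin ha y)
      (surrogateLaw_mem_classSIstr ha y hP hcoin))

theorem exists_map_observe_eq_of_mem_classSI (hP : P ∈ classSI κ p) :
    ∃ f : (Fin p → ℝ) → I → Bool, Measurable (Function.uncurry f) ∧
      (P : Measure (FullData p)).map observe = ((P : Measure (FullData p)).prod volume).map
        (Function.uncurry fun d v => observeAs (f (covariate d) v) d) := by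
  obtain ⟨f, hf, hlaw⟩ := exists_noise_of_condIndepFun measurable_covariate (by fun_prop)
    measurable_treatment hP.2
  refine ⟨f, hf, ?_⟩
  let join : ((Fin p → ℝ) × ℝ × ℝ) × Bool → FullData p := fun z => (z.1.1, z.1.2.1, z.1.2.2, z.2)
  have hjoin : Measurable join := by fun_prop
  have : Measurable fun z : FullData p × I => f (covariate z.1) z.2 :=
    hf.comp ((measurable_covariate.comp measurable_fst).prodMk measurable_snd)
  have hobs := congrArg (Measure.map (observe ∘ join)) hlaw
  rwa [Measure.map_map (measurable_observe.comp hjoin) (by fun_prop),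
    Measure.map_map (measurable_observe.comp hjoin) (by fun_prop)] at hobs

variable [IsProbabilityMeasure ν]

theorem PredictionSet.condMissProb_le_one (ρ : Measure (Fin p → ℝ)) [IsProbabilityMeasure ρ]
    (y : ℝ) (o : Fin n → ObsData p) : C.condMissProb ν ρ y o ≤ 1 := prob_le_one

theorem PredictionSet.missProb_le_iSup_miscoverage_add_not_injective (hP : P ∈ classSI κ p)
    {K : Type*} [Countable K] [MeasurableSpace K] [MeasurableSingletonClass K]
    {q : (Fin p → ℝ) → K} (hq : Measurable q) (y : ℝ) :
    C.missProb ν P y ≤ (⨆ Q ∈ classSIstr κ p, C.miscoverage ν Q) +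
      (Measure.pi fun _ : Fin n => (P : Measure (FullData p)))
        {d | ¬ Function.Injective fun i => q (covariate (d i))} := by
  obtain ⟨f, hf, hlaw⟩ := exists_map_observe_eq_of_mem_classSI hP
  have harm (u : K → I) : Measurable fun x => f x (u (q x)) :=
    hf.comp (measurable_id.prodMk ((measurable_of_countable u).comp hq))
  have hobs : Measurable (Function.uncurry fun d v => observeAs (f (covariate d) v) d) :=
    measurable_observeAs (hf.comp ((measurable_covariate.comp measurable_fst).prodMk
      measurable_snd)) measurable_fst
  rw [C.missProb_eq_lintegral, hlaw]
  refine (lintegral_pi_map_prod_le_add_not_injective _ _ hobs (C.measurable_condMissProb ν _ y)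
    (C.condMissProb_le_one ν _ y) (hq.comp measurable_covariate)).trans (add_le_add_left ?_ _)
  calc ∫⁻ u, ∫⁻ d, C.condMissProb ν ((P : Measure (FullData p)).map covariate) y
          (fun i => observeAs (f (covariate (d i)) (u (q (covariate (d i))))) (d i))
          ∂(Measure.pi fun _ => (P : Measure (FullData p)))
          ∂(Measure.infinitePi fun _ : K => (volume : Measure I))
      ≤ ∫⁻ _, (⨆ Q ∈ classSIstr κ p, C.miscoverage ν Q)
          ∂(Measure.infinitePi fun _ : K => (volume : Measure I)) :=
        lintegral_mono fun u => C.lintegral_condMissProb_observeAs_le ν hP.1 (harm u) y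
    _ = ⨆ Q ∈ classSIstr κ p, C.miscoverage ν Q := by rw [lintegral_const, measure_univ, mul_one]

theorem PredictionSet.missProb_le_iSup_miscoverage (hP : P ∈ classSI κ p) (y : ℝ) :
    C.missProb ν P y ≤ ⨆ Q ∈ classSIstr κ p, C.miscoverage ν Q := by
  obtain ⟨j, hj⟩ := hP.1.1
  have : NullSingletonClass ((P : Measure (FullData p)).map fun d => covariate d j) :=
    ⟨fun x => hj (by simp)⟩
  have hcell (N : ℕ) : Measurable fun t : ℝ => ⌊(N : ℝ) * t⌋ := by fun_prop
  have hcollision := tendsto_pi_not_injective_comp (ι := Fin n) (μ := (P : Measure (FullData p)))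
    (X := fun d => covariate d j) (by fun_prop) hcell fun _ _ => eventually_floor_mul_ne
  have hlim := hcollision.const_add (⨆ Q ∈ classSIstr κ p, C.miscoverage ν Q)
  rw [add_zero] at hlim
  exact ge_of_tendsto' hlim fun N => C.missProb_le_iSup_miscoverage_add_not_injective ν hP
    ((hcell N).comp (measurable_pi_apply j)) y

theorem PredictionSet.expectedLength_eq_lintegral (P : ProbabilityMeasure (FullData p)) :
    C.expectedLength ν P = ∫⁻ y : ℝ, (1 - C.missProb ν P y) := by
  have : IsProbabilityMeasure (experiment n ν P) := by unfold experiment; infer_instance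
  have hdata : Measurable fun w : ((Fin n → FullData p) × S × FullData p) × ℝ =>
      ((fun i => observe (w.1.1 i), w.1.2.1, covariate w.1.2.2, w.2) :
        (Fin n → ObsData p) × S × (Fin p → ℝ) × ℝ) := by fun_prop
  have hgraph : MeasurableSet {w : ((Fin n → FullData p) × S × FullData p) × ℝ |
      w.2 ∈ C.realized w.1} := hdata C.measurable_mem
  calc C.expectedLength ν P
      = ((experiment n ν P).prod volume) {w | w.2 ∈ C.realized w.1} :=
        (Measure.prod_apply hgraph).symm
    _ = ∫⁻ y : ℝ, experiment n ν P {ω | y ∈ C.realized ω} := Measure.prod_apply_symm hgraph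
    _ = ∫⁻ y : ℝ, (1 - C.missProb ν P y) := lintegral_congr fun y => by
        have hcover : MeasurableSet {ω | y ∈ C.realized ω} := measurable_prodMk_right hgraph
        have hcompl := prob_compl_eq_one_sub (μ := experiment n ν P) hcover.compl
        rwa [compl_compl] at hcompl

theorem PredictionSet.expectedLength_eq_top {r : ENNReal} (hr : r < 1)
    (h : ∀ y, C.missProb ν P y ≤ r) : C.expectedLength ν P = ⊤ := by
  rw [C.expectedLength_eq_lintegral, eq_top_iff]
  calc (⊤ : ENNReal) = ∫⁻ _ : ℝ, (1 - r) := by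
        rw [lintegral_const, Real.volume_univ, ENNReal.mul_top (tsub_pos_of_lt hr).ne']
    _ ≤ ∫⁻ y : ℝ, (1 - C.missProb ν P y) := lintegral_mono fun y => tsub_le_tsub_left (h y) 1

end PredictionSets

end ITE

theorem mainTheorem1 (κ : ITE.Continuity) (p : ℕ) (α : ℝ) (hα₀ : 0 ≤ α) (hα₁ : α < 1)
    {S : ℕ → Type*} [∀ n, MeasurableSpace (S n)]
    (ν : ∀ n, Measure (S n)) [∀ n, IsProbabilityMeasure (ν n)]
    (C : ∀ n, ITE.PredictionSet p n (S n))
    (hvalid : limsup (fun n => ⨆ P ∈ ITE.classSIstr κ p, (C n).miscoverage (ν n) P) atTop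
      ≤ ENNReal.ofReal α) :
    ∀ P ∈ ITE.classSI κ p,
      (∀ y : ℝ, limsup (fun n => (C n).missProb (ν n) P y) atTop ≤ ENNReal.ofReal α) ∧
      Tendsto (fun n => (C n).expectedLength (ν n) P) atTop (𝓝 ⊤) := by
  intro P hP
  have hle : ∀ n y, (C n).missProb (ν n) P y ≤
      ⨆ Q ∈ ITE.classSIstr κ p, (C n).miscoverage (ν n) Q :=
    fun n y => (C n).missProb_le_iSup_miscoverage (ν n) hP y
  refine ⟨fun y => (limsup_le_limsup (Eventually.of_forall fun n => hle n y)).trans hvalid, ?_⟩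
  have hlt : limsup (fun n => ⨆ Q ∈ ITE.classSIstr κ p, (C n).miscoverage (ν n) Q) atTop < 1 :=
    hvalid.trans_lt (by simpa using hα₁)
  refine tendsto_const_nhds.congr' ?_
  filter_upwards [eventually_lt_of_limsup_lt hlt] with n hn
  exact ((C n).expectedLength_eq_top (ν n) hn (hle n)).symm
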